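/- **Coherence for representable multicategories.** *Signatures.* A representable signature $\mathcal R$ consists of a set of atoms and a multigraph whose nodes (the *types*) are given by $a ::= o \mid (a_1\otimes\dots\otimes a_k)$, with $o$ an atom and $k\in\mathbb N$. It is *discrete* if it has no multiarrows. *Terms.* The terms over $\mathcal R$, with their typing in ordered contexts of distinct variables (contexts put side by side are disjoint), are given by the rules: $x:a\vdash x:a$; if $\gamma_i\vdash s_i:a_i$ for $1\le i\le k$, then $\gamma_1,\dots,\gamma_k\vdash\langle s_1,\dots,s_k\rangle:(a_1\otimes\dots\otimes a_k)$ and, for every multiarrow $f\in\mathcal R(a_1,\dots,a_k;b)$, $\gamma_1,\dots,\gamma_k\vdash f(s_1,\dots,s_k):b$; if $\gamma\vdash t:(a_1\otimes\dots\otimes a_k)$ and $\delta,x_1:a_1,\dots,x_k:a_k,\delta'\vdash s:b$, then $\delta,\gamma,\delta'\vdash s[x_1,\dots,x_k:=t]:b$ (the $x_i$ are bound in $s$). A *term of type $\gamma;a$* is a term $s$ with $\gamma\vdash s:a$, taken up to renaming of bound and context variables; for $k=0$ the position between $\delta$ and $\delta'$ is part of the term $s[\,:=t]$. *Reduction.*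 Let $\mathtt C$ range over contexts with one hole, $\mathtt E$ over those one-hole contexts that do not end in $s[\vec x:=[\cdot]]$, i.e. whose hole is not the whole right-hand side of an explicit substitution, and $\mathtt L$ over the contexts $\mathtt L::=[\cdot]\mid\mathtt L[\vec x:=t]$. The relation $\to_\beta$ is the closure under all $\mathtt C$ of $$s[x_1,\dots,x_k:=\mathtt L[\langle t_1,\dots,t_k\rangle]]\to_\beta\mathtt L[s\{x_1,\dots,x_k:=t_1,\dots,t_k\}],$$ where $\{\ \}$ is capture-avoiding substitution; $\to_\eta$ is the closure under all $\mathtt E$ of $s\to_\eta\langle\vec x\rangle[\vec x:=s]$, with $\vec x$ fresh, $s$ of tensor type and $s$ not of the form $\mathtt L[\langle s_1,\dots,s_k\rangle]$. Let ${\to_{\mathsf{rep}}}={\to_\beta}\cup{\to_\eta}$, and let $=_{\mathsf{rep}}$ be the equivalence relation it generates; a term is *normal* if it has no $\to_{\mathsf{rep}}$-reduct. *Structural equivalence* $\equiv$ is the smallest congruence with $\mathtt C[s[\vec x:=t]]\equiv\mathtt C[s][\vec x:=t]$ whenever no $x_i$ is free in $\mathtt C$ and $\mathtt C$ binds no variable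 of $t$. Let $\sim$ be the equivalence relation generated by $\equiv$ and $=_{\mathsf{rep}}$. *The free representable multicategory* on $\mathcal R$ has the types as objects and the $\sim$-classes $[s]$ of terms of type $\gamma;a$ as morphisms $\gamma\to a$ (composition is substitution, identities are variables). **Theorem.** Let $\mathcal R$ be a discrete representable signature, $\gamma$ a list of types and $a$ a type. Then any two morphisms $[s],[t]:\gamma\to a$ of the free representable multicategory on $\mathcal R$ are equal. Moreover, any two normal terms $s,t$ of type $\gamma;a$ are structurally equivalent: $s\equiv t$. -/

import Mathlib

universe u v

namespace RepCoh

/-- Types over a set `A` of atoms: `a ::= o ∈ A | (a₁ ⊗ ⋯ ⊗ aₖ)` with `k ∈ ℕ` arbitrary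
(for `k = 0` this is the unit `()`, and the unary tensor `(a)` is different from `a`). -/
inductive RType (A : Type u) : Type u
  | atom : A → RType A
  | tensor : List (RType A) → RType A

/-- A representable signature: a set of atoms and a multigraph whose nodes are the types. -/
structure RepSignature where
  /-- the atoms -/
  Atom : Type u
  /-- the multiarrows `a₁, …, aₙ → b` -/
  Arrow : List (RType Atom) → RType Atom → Type v

/-- The nodes of a signature, that is, the types of the calculus. -/
abbrev RepSignature.Ty (R : RepSignature.{u, v}) : Type u := RType R.Atom

/-- A signature is discrete when its multigraph has no multiarrows. -/
def RepSignature.IsDiscrete (R : RepSignature.{u, v}) : Prop :=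
  ∀ (γ : List R.Ty) (a : R.Ty), IsEmpty (R.Arrow γ a)

variable {R : RepSignature.{u, v}}

mutual
/-- `Tm R Γ a` is the set of representable resource terms `x₁ : a₁, …, xₙ : aₙ ⊢ s : a` over the
signature `R`, with `Γ = a₁, …, aₙ`, up to renaming of all (context and bound) variables.  Contexts
are ordered and each of their variables is used exactly once and in order, so that a variable is
determined by its position in the context and no names are needed. -/
inductive Tm (R : RepSignature.{u, v}) : List R.Ty → R.Ty → Type (max u v)
  /-- `x : a ⊢ x : a` -/
  | var (a : R.Ty) : Tm R [a] a
  /-- `γ₁, …, γₙ ⊢ f(s₁, …, sₙ) : b` -/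
  | op {Γ as : List R.Ty} {b : R.Ty} (f : R.Arrow as b) (ss : Tms R Γ as) : Tm R Γ b
  /-- `γ₁, …, γₖ ⊢ ⟨s₁, …, sₖ⟩ : (a₁ ⊗ ⋯ ⊗ aₖ)` -/
  | tuple {Γ as : List R.Ty} (ss : Tms R Γ as) : Tm R Γ (RType.tensor as)
  /-- The explicit substitution `δ, γ, δ' ⊢ s[x₁, …, xₖ := t] : b`, for
  `δ, x₁ : a₁, …, xₖ : aₖ, δ' ⊢ s : b` and `γ ⊢ t : (a₁ ⊗ ⋯ ⊗ aₖ)`.  The contexts `Δ` of `s` and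
  `Γ` of the result are given through equations, which avoids transports between equal contexts. -/
  | sub {Γ Δ : List R.Ty} {b : R.Ty} (δ as δ' γ : List R.Ty)
      (hΔ : Δ = δ ++ as ++ δ') (hΓ : Γ = δ ++ γ ++ δ')
      (s : Tm R Δ b) (t : Tm R γ (RType.tensor as)) : Tm R Γ b
/-- `Tms R Γ (a₁, …, aₖ)` is the set of sequences `s₁, …, sₖ` of terms `γᵢ ⊢ sᵢ : aᵢ` with
`Γ = γ₁, …, γₖ`. -/
inductive Tms (R : RepSignature.{u, v}) : List R.Ty → List R.Ty → Type (max u v)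
  | nil : Tms R [] []
  | cons {Γ : List R.Ty} {a : R.Ty} {as : List R.Ty} (γ γ' : List R.Ty) (h : Γ = γ ++ γ')
      (s : Tm R γ a) (ss : Tms R γ' as) : Tms R Γ (a :: as)
end

/-! ### Linear substitution -/

/-- The sequence of variables `x₁ : a₁, …, xₖ : aₖ ⊢ x₁, …, xₖ`. -/
def Tms.vars : (as : List R.Ty) → Tms R as as
  | [] => Tms.nil
  | a :: as => Tms.cons [a] as rfl (Tm.var a) (Tms.vars as)

/-- Concatenation of sequences of terms. -/
def Tms.append : {Γ as : List R.Ty} → Tms R Γ as → {Γ' bs : List R.Ty} → Tms R Γ' bs →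
    Tms R (Γ ++ Γ') (as ++ bs)
  | _, _, Tms.nil, _, _, ts => ts
  | _, _, Tms.cons γ γ' h s ss, Γ', _, ts =>
      Tms.cons γ (γ' ++ Γ') (by rw [h, List.append_assoc]) s (Tms.append ss ts)

/-- A splitting of a sequence of terms of types `as, bs` into two sequences. -/
structure Tms.Split (R : RepSignature.{u, v}) (Θ as bs : List R.Ty) where
  /-- the context of the first part -/
  left : List R.Ty
  /-- the context of the second part -/
  right : List R.Ty
  eq : Θ = left ++ right
  /-- the first part -/
  fst : Tms R left as
  /-- the second part -/
  snd : Tms R right bs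

/-- The splitting of a sequence of terms of types `as, bs` after its first `|as|` entries. -/
def Tms.split (bs : List R.Ty) :
    (as : List R.Ty) → {Θ : List R.Ty} → Tms R Θ (as ++ bs) → Tms.Split R Θ as bs
  | [], Θ, σ => ⟨[], Θ, rfl, Tms.nil, σ⟩
  | _ :: as, _, Tms.cons γ _ h s ss =>
      let p := Tms.split bs as ss
      ⟨γ ++ p.left, p.right, h.trans ((congrArg (γ ++ ·) p.eq).trans (List.append_assoc _ _ _).symm),
        Tms.cons γ p.left rfl s p.fst, p.snd⟩

/-- The entry of a sequence of length one. -/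
def Tms.single {Θ : List R.Ty} {a : R.Ty} : Tms R Θ [a] → Tm R Θ a
  | Tms.cons γ _ h s Tms.nil => cast (by rw [h, List.append_nil]) s

mutual
/-- `s.subst (t₁, …, tₙ)` is `s{x₁, …, xₙ := t₁, …, tₙ}`, the simultaneous capture-avoiding
substitution of all the variables of the context of `s`. -/
def Tm.subst : {Γ : List R.Ty} → {a : R.Ty} → Tm R Γ a → {Θ : List R.Ty} → Tms R Θ Γ → Tm R Θ a
  | _, _, Tm.var _, _, σ => σ.single
  | _, _, Tm.op f ss, _, σ => Tm.op f (Tms.subst ss σ)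
  | _, _, Tm.tuple ss, _, σ => Tm.tuple (Tms.subst ss σ)
  | _, _, Tm.sub δ as δ' γ hΔ hΓ s t, _, σ =>
      let p := Tms.split δ' (δ ++ γ) (hΓ ▸ σ)
      let q := Tms.split γ δ p.fst
      Tm.sub q.left as p.right q.right rfl
        (p.eq.trans (congrArg (· ++ p.right) q.eq))
        (s.subst (hΔ ▸ (q.fst.append (Tms.vars as)).append p.snd)) (t.subst q.snd)
/-- Entrywise substitution in a sequence of terms. -/
def Tms.subst : {Γ as : List R.Ty} → Tms R Γ as → {Θ : List R.Ty} → Tms R Θ Γ → Tms R Θ as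
  | _, _, Tms.nil, _, σ => σ
  | _, _, Tms.cons γ γ' h s ss, _, σ =>
      let p := Tms.split γ' γ (h ▸ σ)
      Tms.cons p.left p.right p.eq (s.subst p.fst) (Tms.subst ss p.snd)
end

/-- `s{x₁, …, xₖ := t₁, …, tₖ}` for `δ, x₁ : a₁, …, xₖ : aₖ, δ' ⊢ s : b`: the variables of `δ` and
`δ'` are left alone. -/
def Tm.inst {δ as δ' ζ : List R.Ty} {b : R.Ty} (s : Tm R (δ ++ as ++ δ') b) (ts : Tms R ζ as) :
    Tm R (δ ++ ζ ++ δ') b :=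
  s.subst (((Tms.vars δ).append ts).append (Tms.vars δ'))

/-! ### Substitution contexts -/

/-- Substitution contexts `L ::= [·] | L[x⃗ := t]`, where `LCtx R ζ Γ` consists of those that turn a
term in context `ζ` into a term in context `Γ`. -/
inductive LCtx (R : RepSignature.{u, v}) (ζ : List R.Ty) : List R.Ty → Type (max u v)
  | hole : LCtx R ζ ζ
  | sub {Γ Δ : List R.Ty} (δ as δ' γ : List R.Ty)
      (hΔ : Δ = δ ++ as ++ δ') (hΓ : Γ = δ ++ γ ++ δ')
      (L : LCtx R ζ Δ) (t : Tm R γ (RType.tensor as)) : LCtx R ζ Γ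

/-- `L[s]`, the (capturing) substitution of `s` for the hole. -/
def LCtx.plug {ζ : List R.Ty} {b : R.Ty} : {Γ : List R.Ty} → LCtx R ζ Γ → Tm R ζ b → Tm R Γ b
  | _, LCtx.hole, s => s
  | _, LCtx.sub δ as δ' γ hΔ hΓ L t, s => Tm.sub δ as δ' γ hΔ hΓ (L.plug s) t

/-- The same substitution context, applied to terms with further free variables `δ₀` and `δ₁`. -/
def LCtx.widen {ζ : List R.Ty} (δ₀ δ₁ : List R.Ty) :
    {Γ : List R.Ty} → LCtx R ζ Γ → LCtx R (δ₀ ++ ζ ++ δ₁) (δ₀ ++ Γ ++ δ₁)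
  | _, LCtx.hole => LCtx.hole
  | _, LCtx.sub δ as δ' γ hΔ hΓ L t =>
      LCtx.sub (δ₀ ++ δ) as (δ' ++ δ₁) γ (by rw [hΔ]; simp only [List.append_assoc])
        (by rw [hΓ]; simp only [List.append_assoc]) (L.widen δ₀ δ₁) t

/-- The terms of the shape `L[⟨s₁, …, sₖ⟩]`. -/
def Tm.IsLT {Γ as : List R.Ty} (s : Tm R Γ (RType.tensor as)) : Prop :=
  ∃ (ζ : List R.Ty) (L : LCtx R ζ Γ) (ss : Tms R ζ as), s = L.plug (Tm.tuple ss)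

/-! ### Reduction -/

mutual
/-- One step of `β`-reduction: the closure under all contexts of
`s[x⃗ := L[⟨t₁, …, tₖ⟩]] → L[s{x⃗ := t₁, …, tₖ}]`. -/
inductive Tm.Beta : {Γ : List R.Ty} → {a : R.Ty} → Tm R Γ a → Tm R Γ a → Prop
  | root {Γ Δ ζ : List R.Ty} {b : R.Ty} (δ as δ' γ : List R.Ty)
      (hΔ : Δ = δ ++ as ++ δ') (hΓ : Γ = δ ++ γ ++ δ')
      (s : Tm R Δ b) (L : LCtx R ζ γ) (ts : Tms R ζ as) :
      Tm.Beta (Tm.sub δ as δ' γ hΔ hΓ s (L.plug (Tm.tuple ts)))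
        (hΓ ▸ (L.widen δ δ').plug (Tm.inst (hΔ ▸ s) ts))
  | op {Γ as : List R.Ty} {b : R.Ty} (f : R.Arrow as b) {ss ss' : Tms R Γ as}
      (h : Tms.Beta ss ss') : Tm.Beta (Tm.op f ss) (Tm.op f ss')
  | tuple {Γ as : List R.Ty} {ss ss' : Tms R Γ as}
      (h : Tms.Beta ss ss') : Tm.Beta (Tm.tuple ss) (Tm.tuple ss')
  | body {Γ Δ : List R.Ty} {b : R.Ty} (δ as δ' γ : List R.Ty)
      (hΔ : Δ = δ ++ as ++ δ') (hΓ : Γ = δ ++ γ ++ δ')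
      {s s' : Tm R Δ b} (t : Tm R γ (RType.tensor as)) (h : Tm.Beta s s') :
      Tm.Beta (Tm.sub δ as δ' γ hΔ hΓ s t) (Tm.sub δ as δ' γ hΔ hΓ s' t)
  | arg {Γ Δ : List R.Ty} {b : R.Ty} (δ as δ' γ : List R.Ty)
      (hΔ : Δ = δ ++ as ++ δ') (hΓ : Γ = δ ++ γ ++ δ')
      (s : Tm R Δ b) {t t' : Tm R γ (RType.tensor as)} (h : Tm.Beta t t') :
      Tm.Beta (Tm.sub δ as δ' γ hΔ hΓ s t) (Tm.sub δ as δ' γ hΔ hΓ s t')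
/-- A `β`-step in one entry of a sequence. -/
inductive Tms.Beta : {Γ as : List R.Ty} → Tms R Γ as → Tms R Γ as → Prop
  | head {Γ : List R.Ty} {a : R.Ty} {as : List R.Ty} (γ γ' : List R.Ty) (h : Γ = γ ++ γ')
      {s s' : Tm R γ a} (ss : Tms R γ' as) (hs : Tm.Beta s s') :
      Tms.Beta (Tms.cons γ γ' h s ss) (Tms.cons γ γ' h s' ss)
  | tail {Γ : List R.Ty} {a : R.Ty} {as : List R.Ty} (γ γ' : List R.Ty) (h : Γ = γ ++ γ')
      (s : Tm R γ a) {ss ss' : Tms R γ' as} (hs : Tms.Beta ss ss') :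
      Tms.Beta (Tms.cons γ γ' h s ss) (Tms.cons γ γ' h s ss')
end

/-- The term `⟨x₁, …, xₖ⟩[x₁, …, xₖ := s]`. -/
def Tm.etaExpand {Γ as : List R.Ty} (s : Tm R Γ (RType.tensor as)) : Tm R Γ (RType.tensor as) :=
  Tm.sub [] as [] Γ (by simp) (by simp) (Tm.tuple (Tms.vars as)) s

mutual
/-- `s.EtaAt r s'`: the term `s'` arises from `s` by one `η`-step
`p → ⟨x⃗⟩[x⃗ := p]` (with `p` of tensor type and not of the shape `L[⟨s₁, …, sₖ⟩]`) inside a context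
`E ::= [·] | ⟨s₁, …, E, …, sₖ⟩ | f(s₁, …, E, …, sₖ) | E[x⃗ := s] | s[x⃗ := E]` with `E ≠ [·]` in the
last case.  The flag `r` is `true` if `E = [·]` and `false` otherwise. -/
inductive Tm.EtaAt : {Γ : List R.Ty} → {a : R.Ty} → Bool → Tm R Γ a → Tm R Γ a → Prop
  | root {Γ as : List R.Ty} (s : Tm R Γ (RType.tensor as)) (h : ¬ s.IsLT) :
      Tm.EtaAt true s s.etaExpand
  | op {Γ as : List R.Ty} {b : R.Ty} (f : R.Arrow as b) {ss ss' : Tms R Γ as}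
      (h : Tms.Eta ss ss') : Tm.EtaAt false (Tm.op f ss) (Tm.op f ss')
  | tuple {Γ as : List R.Ty} {ss ss' : Tms R Γ as}
      (h : Tms.Eta ss ss') : Tm.EtaAt false (Tm.tuple ss) (Tm.tuple ss')
  | body {Γ Δ : List R.Ty} {b : R.Ty} (δ as δ' γ : List R.Ty)
      (hΔ : Δ = δ ++ as ++ δ') (hΓ : Γ = δ ++ γ ++ δ') (r : Bool)
      {s s' : Tm R Δ b} (t : Tm R γ (RType.tensor as)) (h : Tm.EtaAt r s s') :
      Tm.EtaAt false (Tm.sub δ as δ' γ hΔ hΓ s t) (Tm.sub δ as δ' γ hΔ hΓ s' t)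
  | arg {Γ Δ : List R.Ty} {b : R.Ty} (δ as δ' γ : List R.Ty)
      (hΔ : Δ = δ ++ as ++ δ') (hΓ : Γ = δ ++ γ ++ δ')
      (s : Tm R Δ b) {t t' : Tm R γ (RType.tensor as)} (h : Tm.EtaAt false t t') :
      Tm.EtaAt false (Tm.sub δ as δ' γ hΔ hΓ s t) (Tm.sub δ as δ' γ hΔ hΓ s t')
/-- An `η`-step in one entry of a sequence. -/
inductive Tms.Eta : {Γ as : List R.Ty} → Tms R Γ as → Tms R Γ as → Prop
  | head {Γ : List R.Ty} {a : R.Ty} {as : List R.Ty} (γ γ' : List R.Ty) (h : Γ = γ ++ γ')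
      (r : Bool) {s s' : Tm R γ a} (ss : Tms R γ' as) (hs : Tm.EtaAt r s s') :
      Tms.Eta (Tms.cons γ γ' h s ss) (Tms.cons γ γ' h s' ss)
  | tail {Γ : List R.Ty} {a : R.Ty} {as : List R.Ty} (γ γ' : List R.Ty) (h : Γ = γ ++ γ')
      (s : Tm R γ a) {ss ss' : Tms R γ' as} (hs : Tms.Eta ss ss') :
      Tms.Eta (Tms.cons γ γ' h s ss) (Tms.cons γ γ' h s ss')
end

/-- One step of `η`-reduction. -/
def Tm.Eta {Γ : List R.Ty} {a : R.Ty} (s s' : Tm R Γ a) : Prop := ∃ r : Bool, Tm.EtaAt r s s'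

/-- One step of the reduction `→_rep = →_β ∪ →_η`. -/
def Tm.Red {Γ : List R.Ty} {a : R.Ty} (s s' : Tm R Γ a) : Prop := s.Beta s' ∨ s.Eta s'

/-- Normal forms for `→_rep`. -/
def Tm.IsNormal {Γ : List R.Ty} {a : R.Ty} (s : Tm R Γ a) : Prop := ∀ s' : Tm R Γ a, ¬ s.Red s'

/-- `=_rep`, the equivalence relation generated by `→_rep`. -/
def Tm.RedEq {Γ : List R.Ty} {a : R.Ty} : Tm R Γ a → Tm R Γ a → Prop :=
  Relation.EqvGen Tm.Red

/-! ### Structural equivalence -/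

mutual
/-- Structural equivalence `s ≡ s'`: the smallest congruence such that
`C[s[x⃗ := t]] ≡ C[s][x⃗ := t]` for all contexts `C` in which no `xᵢ` is free and that bind no variable
of `t`.  It suffices to generate it by the contexts `C` of depth one. -/
inductive Tm.Equiv : {Γ : List R.Ty} → {a : R.Ty} → Tm R Γ a → Tm R Γ a → Prop
  | refl {Γ : List R.Ty} {a : R.Ty} (s : Tm R Γ a) : Tm.Equiv s s
  | symm {Γ : List R.Ty} {a : R.Ty} {s s' : Tm R Γ a} (h : Tm.Equiv s s') : Tm.Equiv s' s
  | trans {Γ : List R.Ty} {a : R.Ty} {s s' s'' : Tm R Γ a} (h : Tm.Equiv s s')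
      (h' : Tm.Equiv s' s'') : Tm.Equiv s s''
  | op {Γ as : List R.Ty} {b : R.Ty} (f : R.Arrow as b) {ss ss' : Tms R Γ as}
      (h : Tms.Equiv ss ss') : Tm.Equiv (Tm.op f ss) (Tm.op f ss')
  | tuple {Γ as : List R.Ty} {ss ss' : Tms R Γ as}
      (h : Tms.Equiv ss ss') : Tm.Equiv (Tm.tuple ss) (Tm.tuple ss')
  | sub {Γ Δ : List R.Ty} {b : R.Ty} (δ as δ' γ : List R.Ty)
      (hΔ : Δ = δ ++ as ++ δ') (hΓ : Γ = δ ++ γ ++ δ')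
      {s s' : Tm R Δ b} {t t' : Tm R γ (RType.tensor as)}
      (hs : Tm.Equiv s s') (ht : Tm.Equiv t t') :
      Tm.Equiv (Tm.sub δ as δ' γ hΔ hΓ s t) (Tm.sub δ as δ' γ hΔ hΓ s' t')
  /-- `f(u⃗, s[x⃗ := t], v⃗) ≡ f(u⃗, s, v⃗)[x⃗ := t]` -/
  | opComm {Γu as δ xs δ' γ Γv bs : List R.Ty} {a b : R.Ty} (f : R.Arrow (as ++ a :: bs) b)
      (us : Tms R Γu as) (s : Tm R (δ ++ xs ++ δ') a) (t : Tm R γ (RType.tensor xs))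
      (vs : Tms R Γv bs) :
      Tm.Equiv
        (Tm.op f (us.append (Tms.cons (δ ++ γ ++ δ') Γv rfl
          (Tm.sub δ xs δ' γ rfl rfl s t) vs)))
        (Tm.sub (Γu ++ δ) xs (δ' ++ Γv) γ (by simp only [List.append_assoc])
          (by simp only [List.append_assoc])
          (Tm.op f (us.append (Tms.cons (δ ++ xs ++ δ') Γv rfl s vs))) t)
  /-- `⟨u⃗, s[x⃗ := t], v⃗⟩ ≡ ⟨u⃗, s, v⃗⟩[x⃗ := t]` -/
  | tupleComm {Γu as δ xs δ' γ Γv bs : List R.Ty} {a : R.Ty}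
      (us : Tms R Γu as) (s : Tm R (δ ++ xs ++ δ') a) (t : Tm R γ (RType.tensor xs))
      (vs : Tms R Γv bs) :
      Tm.Equiv
        (Tm.tuple (us.append (Tms.cons (δ ++ γ ++ δ') Γv rfl
          (Tm.sub δ xs δ' γ rfl rfl s t) vs)))
        (Tm.sub (Γu ++ δ) xs (δ' ++ Γv) γ (by simp only [List.append_assoc])
          (by simp only [List.append_assoc])
          (Tm.tuple (us.append (Tms.cons (δ ++ xs ++ δ') Γv rfl s vs))) t)
  /-- `s[x⃗ := t][y⃗ := u] ≡ s[y⃗ := u][x⃗ := t]`, if no `yⱼ` is free in `t`.  Here `y⃗` stands to the left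
  of `x⃗` in the context `δ₁, y⃗, δ₂, x⃗, δ₃` of `s`; the other case is this one read backwards. -/
  | bodyComm {δ₁ ys δ₂ xs δ₃ γ γ' : List R.Ty} {b : R.Ty}
      (s : Tm R (δ₁ ++ ys ++ δ₂ ++ xs ++ δ₃) b)
      (t : Tm R γ (RType.tensor xs)) (u : Tm R γ' (RType.tensor ys)) :
      Tm.Equiv
        (Tm.sub (Γ := δ₁ ++ γ' ++ δ₂ ++ γ ++ δ₃) (Δ := δ₁ ++ ys ++ δ₂ ++ γ ++ δ₃)
          δ₁ ys (δ₂ ++ γ ++ δ₃) γ' (by simp only [List.append_assoc])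
          (by simp only [List.append_assoc])
          (Tm.sub (δ₁ ++ ys ++ δ₂) xs δ₃ γ rfl rfl s t) u)
        (Tm.sub (δ₁ ++ γ' ++ δ₂) xs δ₃ γ rfl rfl
          (Tm.sub δ₁ ys (δ₂ ++ xs ++ δ₃) γ' (by simp only [List.append_assoc])
            (by simp only [List.append_assoc]) s u) t)
  /-- `p[y⃗ := s[x⃗ := t]] ≡ p[y⃗ := s][x⃗ := t]` -/
  | argComm {δ ys δ' ε xs ε' γ : List R.Ty} {b : R.Ty} (p : Tm R (δ ++ ys ++ δ') b)
      (s : Tm R (ε ++ xs ++ ε') (RType.tensor ys)) (t : Tm R γ (RType.tensor xs)) :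
      Tm.Equiv
        (Tm.sub δ ys δ' (ε ++ γ ++ ε') rfl rfl p (Tm.sub ε xs ε' γ rfl rfl s t))
        (Tm.sub (δ ++ ε) xs (ε' ++ δ') γ (by simp only [List.append_assoc])
          (by simp only [List.append_assoc])
          (Tm.sub δ ys δ' (ε ++ xs ++ ε') rfl rfl p s) t)
/-- Entrywise structural equivalence of sequences. -/
inductive Tms.Equiv : {Γ as : List R.Ty} → Tms R Γ as → Tms R Γ as → Prop
  | nil : Tms.Equiv Tms.nil Tms.nil
  | cons {Γ : List R.Ty} {a : R.Ty} {as : List R.Ty} (γ γ' : List R.Ty) (h : Γ = γ ++ γ')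
      {s s' : Tm R γ a} {ss ss' : Tms R γ' as} (hs : Tm.Equiv s s') (hss : Tms.Equiv ss ss') :
      Tms.Equiv (Tms.cons γ γ' h s ss) (Tms.cons γ γ' h s' ss')
end

/-! ### The free representable multicategory -/

/-- `∼`, the equivalence relation generated by `≡` and `=_rep`. -/
def Tm.simSetoid (R : RepSignature.{u, v}) (Γ : List R.Ty) (a : R.Ty) : Setoid (Tm R Γ a) :=
  Relation.EqvGen.setoid fun s t => Tm.Equiv s t ∨ Tm.RedEq s t

/-- The morphisms `Γ → a` of the free representable multicategory on the signature `R`, whose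
objects are the types: classes `[s]` of terms of type `Γ; a` modulo `∼`. -/
def FreeRM (R : RepSignature.{u, v}) (Γ : List R.Ty) (a : R.Ty) : Type (max u v) :=
  Quotient (Tm.simSetoid R Γ a)

end RepCoh

/-!
Over a discrete signature a term only regroups its variables, and both parts say that there is
just one way to do so. The terms of reference are the tuple trees `Tm.IsTree`: terms built by tupling
from variables of atomic type. A tuple tree is determined by its type (`Tm.IsTree.unique`).

*Any two terms are equivalent up to `∼`.* Substituting tuple trees for all the variables of a term
gives a term equivalent to a tuple tree (`Tm.subst_sim_isTree`), so any two terms of the same context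
and type become equivalent under such a substitution. Nothing is lost by it
(`Tm.Sim.of_forall_subst_isTree`): for a variable `x` of tensor type, `η` and structural equivalence
give `s ∼ s{x := ⟨y⃗⟩}[y⃗ := x]` (`Tm.Sim.sub_inst`), so that `s` can be recovered from its instance
at `⟨y⃗⟩`, and repeating this one arrives at a context of atoms. The laws of substitution that are
needed are few, since `s{x⃗ := t⃗}` is a `β`-reduct of `s[x⃗ := ⟨t⃗⟩]`: compatibility with `∼` and
composition (`Tm.Sim.subst_subst`) are inherited from explicit substitution.

*Any two normal terms are structurally equivalent.* In a normal term the right-hand sides of explicit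
substitutions are variables (`Tm.exists_eq_var`), and by `η` every other variable has atomic type.
Moving all explicit substitutions outwards gives a tuple tree followed by the opening of all
variables of tensor type (`Tm.IsOpened`, `Tm.opens_of_normal`). Such terms can differ only in the
order in which the variables are opened, and independent openings commute
(`Tm.IsOpened.exists_equiv_sub`), so they are structurally equivalent (`Tm.IsOpened.equiv`).
-/

namespace RepCoh

variable {R : RepSignature.{u, v}}

/-! ### Sequences of terms -/

/-- Contexts that are equal only propositionally make reassociations of sequences heterogeneous;
this congruence lifts such an equality of tails. -/
theorem Tms.cons_heq_cons {Γ Γ' γ γ₁ γ₂ as as' : List R.Ty} {a : R.Ty} (hΓ : Γ = Γ')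
    (h : Γ = γ ++ γ₁) (h' : Γ' = γ ++ γ₂) (s : Tm R γ a) {ss : Tms R γ₁ as} {ss' : Tms R γ₂ as'}
    (hγ : γ₁ = γ₂) (has : as = as') (hss : HEq ss ss') :
    HEq (Tms.cons γ γ₁ h s ss) (Tms.cons γ γ₂ h' s ss') := by
  subst hΓ hγ has
  cases hss
  rfl

theorem Tms.append_assoc : ∀ {Γ₁ as : List R.Ty} (σ : Tms R Γ₁ as) {Γ₂ bs Γ₃ cs : List R.Ty}
    (τ : Tms R Γ₂ bs) (ρ : Tms R Γ₃ cs),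
    HEq ((σ.append τ).append ρ) (σ.append (τ.append ρ))
  | _, _, Tms.nil, _, _, _, _, _, _ => HEq.rfl
  | _, _, Tms.cons γ γ' h s ss, _, _, _, _, τ, ρ => by
      rw [Tms.append, Tms.append, Tms.append]
      exact Tms.cons_heq_cons (List.append_assoc _ _ _) _ _ s (List.append_assoc _ _ _)
        (List.append_assoc _ _ _) (Tms.append_assoc ss τ ρ)

theorem Tms.append_nil : ∀ {Γ as : List R.Ty} (σ : Tms R Γ as), HEq (σ.append Tms.nil) σ
  | _, _, Tms.nil => HEq.rfl
  | _, _, Tms.cons γ γ' h s ss => by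
      rw [Tms.append]
      exact Tms.cons_heq_cons (List.append_nil _) _ _ s (List.append_nil _)
        (List.append_nil _) (Tms.append_nil ss)

theorem Tms.vars_append : ∀ as bs : List R.Ty,
    Tms.vars (R := R) (as ++ bs) = (Tms.vars as).append (Tms.vars bs)
  | [], _ => rfl
  | a :: as, bs => by
      rw [Tms.vars, Tms.append, ← Tms.vars_append as bs]
      rfl

theorem Tms.split_append : ∀ {Γ as : List R.Ty} (σ : Tms R Γ as) {Γ' bs : List R.Ty}
    (τ : Tms R Γ' bs), Tms.split bs as (σ.append τ) = ⟨Γ, Γ', rfl, σ, τ⟩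
  | _, _, Tms.nil, _, _, _ => rfl
  | _, _, Tms.cons γ γ' h s ss, _, _, τ => by
      subst h
      have key : ∀ p : Tms.Split R _ _ _, p = ⟨γ', _, rfl, ss, τ⟩ →
          ∀ e e', (⟨γ ++ p.left, p.right, e, Tms.cons γ p.left e' s p.fst, p.snd⟩ :
            Tms.Split R _ (_ :: _) _) = ⟨γ ++ γ', _, rfl, Tms.cons γ γ' rfl s ss, τ⟩ := by
        rintro _ rfl _ _
        rfl
      exact key _ (Tms.split_append ss τ) _ _

/-- Every sequence of terms of types `as, bs` is a concatenation; as the equation between the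
contexts has a variable on its right, it can be eliminated, which leaves no transport. -/
theorem Tms.exists_eq_append (bs : List R.Ty) : ∀ (as : List R.Ty) {Θ : List R.Ty}
    (σ : Tms R Θ (as ++ bs)), ∃ (Θ₁ Θ₂ : List R.Ty) (h : Θ₁ ++ Θ₂ = Θ) (σ₁ : Tms R Θ₁ as)
      (σ₂ : Tms R Θ₂ bs), σ = h ▸ σ₁.append σ₂
  | [], Θ, σ => ⟨[], Θ, rfl, Tms.nil, σ, rfl⟩
  | _ :: as, _, Tms.cons γ γ' h s ss => by
      obtain ⟨Θ₁, Θ₂, e, σ₁, σ₂, rfl⟩ := Tms.exists_eq_append bs as ss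
      subst e h
      exact ⟨γ ++ Θ₁, Θ₂, List.append_assoc _ _ _, Tms.cons γ Θ₁ rfl s σ₁, σ₂, by
        apply eq_of_heq
        rw [heq_eqRec_iff]
        exact Tms.cons_heq_cons (List.append_assoc _ _ _).symm _ _ s rfl rfl HEq.rfl⟩

/-! ### Computing substitutions -/

theorem Tms.subst_cons {γ γ' as Θ₁ Θ₂ : List R.Ty} {a : R.Ty} (s : Tm R γ a) (ss : Tms R γ' as)
    (σ : Tms R Θ₁ γ) (τ : Tms R Θ₂ γ') :
    (Tms.cons γ γ' rfl s ss).subst (σ.append τ) =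
      Tms.cons Θ₁ Θ₂ rfl (s.subst σ) (ss.subst τ) := by
  -- The equation `p.eq` depends on the splitting `p`, so `p` is replaced in all places at once.
  have key : ∀ p : Tms.Split R (Θ₁ ++ Θ₂) γ γ', p = ⟨_, _, rfl, σ, τ⟩ →
      Tms.cons p.left p.right p.eq (s.subst p.fst) (ss.subst p.snd) =
        Tms.cons Θ₁ Θ₂ rfl (s.subst σ) (ss.subst τ) := by
    rintro _ rfl
    rfl
  exact key _ (Tms.split_append σ τ)

theorem Tm.subst_sub {δ as δ' γ Θ₁ Θ₂ Θ₃ : List R.Ty} {b : R.Ty} (s : Tm R (δ ++ as ++ δ') b)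
    (t : Tm R γ (RType.tensor as)) (σ₁ : Tms R Θ₁ δ) (σ₂ : Tms R Θ₂ γ) (σ₃ : Tms R Θ₃ δ') :
    (Tm.sub δ as δ' γ rfl rfl s t).subst ((σ₁.append σ₂).append σ₃) =
      Tm.sub Θ₁ as Θ₃ Θ₂ rfl rfl (s.subst ((σ₁.append (Tms.vars as)).append σ₃))
        (t.subst σ₂) := by
  have key : ∀ p : Tms.Split R (Θ₁ ++ Θ₂ ++ Θ₃) (δ ++ γ) δ', p = ⟨_, _, rfl, σ₁.append σ₂, σ₃⟩ →
      ∀ q : Tms.Split R p.left δ γ, HEq q (⟨_, _, rfl, σ₁, σ₂⟩ : Tms.Split R _ δ γ) → ∀ e,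
      Tm.sub q.left as p.right q.right rfl e
        (s.subst ((q.fst.append (Tms.vars as)).append p.snd)) (t.subst q.snd) =
      Tm.sub Θ₁ as Θ₃ Θ₂ rfl rfl (s.subst ((σ₁.append (Tms.vars as)).append σ₃))
        (t.subst σ₂) := by
    rintro _ rfl q hq _
    cases hq
    rfl
  have h := Tms.split_append (σ₁.append σ₂) σ₃
  refine key _ h _ ?_ _
  change HEq (Tms.split γ δ (Tms.split δ' (δ ++ γ) ((σ₁.append σ₂).append σ₃)).fst) _
  rw [h, Tms.split_append]

theorem Tms.single_vars (a : R.Ty) : (Tms.vars [a]).single = Tm.var a := rfl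

mutual
theorem Tm.subst_vars : ∀ {Γ : List R.Ty} {a : R.Ty} (s : Tm R Γ a), s.subst (Tms.vars Γ) = s
  | _, _, Tm.var a => by rw [Tm.subst, Tms.single_vars]
  | _, _, Tm.op f ss => by rw [Tm.subst, Tms.subst_vars ss]
  | _, _, Tm.tuple ss => by rw [Tm.subst, Tms.subst_vars ss]
  | _, _, Tm.sub δ as δ' γ hΔ hΓ s t => by
      have hs := Tm.subst_vars s
      have ht := Tm.subst_vars t
      subst hΔ hΓ
      rw [Tms.vars_append, Tms.vars_append, Tm.subst_sub, ht, ← Tms.vars_append,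
        ← Tms.vars_append, hs]
theorem Tms.subst_vars : ∀ {Γ as : List R.Ty} (ss : Tms R Γ as), ss.subst (Tms.vars Γ) = ss
  | _, _, Tms.nil => rfl
  | _, _, Tms.cons γ γ' h s ss => by
      have hs := Tm.subst_vars s
      have hss := Tms.subst_vars ss
      subst h
      rw [Tms.vars_append, Tms.subst_cons, hs, hss]
end

theorem Tms.cons_single {Γ γ₁ γ γ' as : List R.Ty} {a : R.Ty} (h : Γ = γ₁ ++ γ')
    (h₁ : γ₁ = γ ++ []) (s : Tm R γ a) (ss : Tms R γ' as) (h' : Γ = γ ++ γ') :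
    Tms.cons γ₁ γ' h (Tms.single (Tms.cons γ [] h₁ s Tms.nil)) ss = Tms.cons γ γ' h' s ss := by
  obtain rfl : γ₁ = γ := by simpa using h₁
  rfl

theorem Tms.vars_subst : ∀ {as Θ : List R.Ty} (σ : Tms R Θ as), (Tms.vars as).subst σ = σ
  | _, _, Tms.nil => rfl
  | _, _, Tms.cons γ γ' h s ss => by
      subst h
      have key : ∀ ss' : Tms R γ' _, ss' = ss → ∀ e e',
          Tms.cons (γ ++ []) γ' e (Tms.single (Tms.cons γ [] e' s Tms.nil)) ss' =
            Tms.cons γ γ' rfl s ss := by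
        rintro _ rfl _ _
        exact Tms.cons_single _ _ _ _ _
      exact key _ (Tms.vars_subst ss) _ _

theorem Tms.subst_append : ∀ {Γ as : List R.Ty} (σ : Tms R Γ as) {Γ' bs Θ Θ' : List R.Ty}
    (τ : Tms R Γ' bs) (ρ : Tms R Θ Γ) (ρ' : Tms R Θ' Γ'),
    (σ.append τ).subst (ρ.append ρ') = (σ.subst ρ).append (τ.subst ρ')
  | _, _, Tms.nil, _, _, _, _, _, Tms.nil, _ => rfl
  | _, _, Tms.cons γ γ' h s ss, Γ', _, Θ, Θ', τ, ρ, ρ' => by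
      subst h
      obtain ⟨Θ₁, Θ₂, rfl, ρ₁, ρ₂, rfl⟩ := Tms.exists_eq_append γ' γ ρ
      rw [Tms.subst_cons]
      have key : ∀ p : Tms.Split R (Θ₁ ++ Θ₂ ++ Θ') γ (γ' ++ Γ'),
          p = ⟨Θ₁, Θ₂ ++ Θ', List.append_assoc _ _ _, ρ₁, ρ₂.append ρ'⟩ →
          Tms.cons p.left p.right p.eq (s.subst p.fst) ((ss.append τ).subst p.snd) =
            (Tms.cons Θ₁ Θ₂ rfl (s.subst ρ₁) (ss.subst ρ₂)).append (τ.subst ρ') := by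
        rintro _ rfl
        simp only [Tms.append]
        rw [Tms.subst_append ss τ ρ₂ ρ']
      have split_eq : ∀ {Ξ : List R.Ty} (e : Ξ = Θ₁ ++ (Θ₂ ++ Θ'))
          (σ : Tms R Ξ (γ ++ (γ' ++ Γ'))), HEq σ (ρ₁.append (ρ₂.append ρ')) →
          Tms.split (γ' ++ Γ') γ σ = ⟨Θ₁, Θ₂ ++ Θ', e, ρ₁, ρ₂.append ρ'⟩ := by
        intro Ξ e σ hσ
        subst e
        rw [eq_of_heq hσ, Tms.split_append]
      refine key _ (split_eq _ _ ?_)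
      rw [eqRec_heq_iff]
      exact Tms.append_assoc _ _ _


/-! ### Trees of variables of atomic type -/

mutual
/-- Tuple trees: the terms built by tupling from variables of atomic type. -/
def Tm.IsTree : {Γ : List R.Ty} → {a : R.Ty} → Tm R Γ a → Prop
  | _, _, Tm.var a => ∃ o : R.Atom, a = RType.atom o
  | _, _, Tm.op _ _ => False
  | _, _, Tm.tuple ss => Tms.IsTree ss
  | _, _, Tm.sub _ _ _ _ _ _ _ _ => False
/-- Sequences of tuple trees. -/
def Tms.IsTree : {Γ as : List R.Ty} → Tms R Γ as → Prop
  | _, _, Tms.nil => True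
  | _, _, Tms.cons _ _ _ s ss => Tm.IsTree s ∧ Tms.IsTree ss
end

mutual
/-- A tuple tree is determined by its type, which also determines its context: the list of the atoms
of the type. -/
theorem Tm.IsTree.unique : ∀ {Γ : List R.Ty} {a : R.Ty} {s : Tm R Γ a}, s.IsTree →
    ∀ {Γ' : List R.Ty} {t : Tm R Γ' a}, t.IsTree → Γ = Γ' ∧ HEq s t
  | _, _, Tm.var _, _, _, Tm.var _, _ => ⟨rfl, HEq.rfl⟩
  | _, _, Tm.var _, hs, _, Tm.tuple _, _ => by
      obtain ⟨_, ho⟩ := hs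
      cases ho
  | _, _, Tm.tuple _, _, _, Tm.var _, ht => by
      obtain ⟨_, ho⟩ := ht
      cases ho
  | _, _, Tm.tuple ss, hs, _, Tm.tuple ts, ht => by
      obtain ⟨rfl, h⟩ := Tms.IsTree.unique (ss := ss) hs (ts := ts) ht
      cases h
      exact ⟨rfl, HEq.rfl⟩
theorem Tms.IsTree.unique : ∀ {Γ as : List R.Ty} {ss : Tms R Γ as}, ss.IsTree →
    ∀ {Γ' : List R.Ty} {ts : Tms R Γ' as}, ts.IsTree → Γ = Γ' ∧ HEq ss ts
  | _, _, Tms.nil, _, _, Tms.nil, _ => ⟨rfl, HEq.rfl⟩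
  | _, _, Tms.cons _ _ h s ss, hs, _, Tms.cons _ _ h' t ts, ht => by
      obtain ⟨rfl, h₁⟩ := Tm.IsTree.unique (s := s) hs.1 (t := t) ht.1
      obtain ⟨rfl, h₂⟩ := Tms.IsTree.unique (ss := ss) hs.2 (ts := ts) ht.2
      cases h₁
      cases h₂
      exact ⟨h.trans h'.symm, Tms.cons_heq_cons (h.trans h'.symm) _ _ _ rfl rfl HEq.rfl⟩
end

theorem Tm.IsTree.eq {Γ : List R.Ty} {a : R.Ty} {s t : Tm R Γ a} (hs : s.IsTree) (ht : t.IsTree) :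
    s = t :=
  eq_of_heq (hs.unique ht).2

mutual
theorem Tm.IsTree.eq_atom_of_mem : ∀ {Γ : List R.Ty} {a : R.Ty} {s : Tm R Γ a}, s.IsTree →
    ∀ x ∈ Γ, ∃ o : R.Atom, x = RType.atom o
  | _, _, Tm.var _, hs, x, hx => by
      rw [List.mem_singleton] at hx
      exact hx ▸ hs
  | _, _, Tm.tuple ss, hs, x, hx => Tms.IsTree.eq_atom_of_mem (ss := ss) hs x hx
theorem Tms.IsTree.eq_atom_of_mem : ∀ {Γ as : List R.Ty} {ss : Tms R Γ as}, ss.IsTree →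
    ∀ x ∈ Γ, ∃ o : R.Atom, x = RType.atom o
  | _, _, Tms.cons _ _ h s ss, hs, x, hx => by
      rw [h, List.mem_append] at hx
      exact hx.elim (Tm.IsTree.eq_atom_of_mem (s := s) hs.1 x)
        (Tms.IsTree.eq_atom_of_mem (ss := ss) hs.2 x)
end

theorem Tms.isTree_append : ∀ {Γ as : List R.Ty} (σ : Tms R Γ as) {Γ' bs : List R.Ty}
    (τ : Tms R Γ' bs), (σ.append τ).IsTree ↔ σ.IsTree ∧ τ.IsTree
  | _, _, Tms.nil, _, _, τ => by simp [Tms.append, Tms.IsTree]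
  | _, _, Tms.cons _ _ _ s ss, _, _, τ => by
      simp [Tms.append, Tms.IsTree, Tms.isTree_append ss τ, and_assoc]

theorem Tms.isTree_vars : ∀ {Γ : List R.Ty}, (∀ x ∈ Γ, ∃ o : R.Atom, x = RType.atom o) →
    (Tms.vars (R := R) Γ).IsTree
  | [], _ => trivial
  | a :: _, h => ⟨h a List.mem_cons_self,
      Tms.isTree_vars fun x hx => h x (List.mem_cons_of_mem a hx)⟩

theorem Tm.IsTree.exists_eq_tuple {Γ as : List R.Ty} {s : Tm R Γ (RType.tensor as)}
    (hs : s.IsTree) : ∃ ss : Tms R Γ as, ss.IsTree ∧ s = Tm.tuple ss := by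
  cases s with
  | var a => obtain ⟨o, ho⟩ := hs; cases ho
  | op f ss => exact hs.elim
  | tuple ss => exact ⟨ss, hs, rfl⟩
  | sub _ _ _ _ _ _ _ _ => exact hs.elim

/-! ### The equivalence generated by reduction and structural equivalence -/

theorem Tms.Equiv.rfl : ∀ {Γ as : List R.Ty} {ss : Tms R Γ as}, Tms.Equiv ss ss
  | _, _, Tms.nil => Tms.Equiv.nil
  | _, _, Tms.cons γ γ' h s _ => Tms.Equiv.cons γ γ' h (Tm.Equiv.refl s) Tms.Equiv.rfl

/-- `argComm` with all contexts given up to equations, so that it applies without transports. -/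
theorem Tm.Equiv.argComm' {Γ Γ₁ Δ₁ Δ₂ Δ₃ δ ys δ' ε xs ε' γ δ₀ δ₀' : List R.Ty} {b : R.Ty}
    (h₁ : Δ₁ = δ ++ ys ++ δ') (h₂ : Γ = δ ++ Γ₁ ++ δ') (h₃ : Δ₂ = ε ++ xs ++ ε')
    (h₄ : Γ₁ = ε ++ γ ++ ε') (h₅ : Δ₃ = δ₀ ++ xs ++ δ₀') (h₆ : Γ = δ₀ ++ γ ++ δ₀')
    (h₇ : Δ₃ = δ ++ Δ₂ ++ δ') (e : δ₀ = δ ++ ε) (e' : δ₀' = ε' ++ δ')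
    (p : Tm R Δ₁ b) (s : Tm R Δ₂ (RType.tensor ys)) (t : Tm R γ (RType.tensor xs)) :
    Tm.Equiv (Tm.sub δ ys δ' Γ₁ h₁ h₂ p (Tm.sub ε xs ε' γ h₃ h₄ s t))
      (Tm.sub δ₀ xs δ₀' γ h₅ h₆ (Tm.sub δ ys δ' Δ₂ h₁ h₇ p s) t) := by
  subst e e' h₁ h₃ h₄ h₂ h₇
  exact Tm.Equiv.argComm p s t

/-- `tupleComm` with the contexts of the explicit substitution given up to equations. -/
theorem Tm.Equiv.tupleComm' {Γu as Δ Γ δ xs δ' γ Γv bs : List R.Ty} {a : R.Ty}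
    (h₁ : Δ = δ ++ xs ++ δ') (h₂ : Γ = δ ++ γ ++ δ') (us : Tms R Γu as) (s : Tm R Δ a)
    (t : Tm R γ (RType.tensor xs)) (vs : Tms R Γv bs) :
    Tm.Equiv
      (Tm.tuple (us.append (Tms.cons Γ Γv rfl (Tm.sub δ xs δ' γ h₁ h₂ s t) vs)))
      (Tm.sub (Γu ++ δ) xs (δ' ++ Γv) γ (by simp only [h₁, List.append_assoc])
        (by simp only [h₂, List.append_assoc])
        (Tm.tuple (us.append (Tms.cons Δ Γv rfl s vs))) t) := by
  subst h₁ h₂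
  exact Tm.Equiv.tupleComm us s t vs

/-- The equivalence relation `∼`, generated by structural equivalence together with single reduction
steps (rather than with the equivalence `=_rep`, which gives the same relation). -/
def Tm.Sim {Γ : List R.Ty} {a : R.Ty} : Tm R Γ a → Tm R Γ a → Prop :=
  Relation.EqvGen fun s t => Tm.Equiv s t ∨ Tm.Red s t

/-- The version of `∼` for sequences, whose generators act on one sequence as a whole; this makes its
compatibility with `Tm.tuple` immediate. -/
def Tms.Sim {Γ as : List R.Ty} : Tms R Γ as → Tms R Γ as → Prop :=
  Relation.EqvGen fun ss ts => Tms.Equiv ss ts ∨ Tms.Beta ss ts ∨ Tms.Eta ss ts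

theorem eqvGen_lift {α β : Type*} {r : α → α → Prop} {p : β → β → Prop} (f : α → β)
    (h : ∀ x y, r x y → Relation.EqvGen p (f x) (f y)) {x y : α} (hxy : Relation.EqvGen r x y) :
    Relation.EqvGen p (f x) (f y) := by
  induction hxy with
  | rel x y hr => exact h x y hr
  | refl x => exact .refl _
  | symm x y _ ih => exact .symm _ _ ih
  | trans x y z _ _ ih ih' => exact .trans _ _ _ ih ih'

namespace Tm.Sim

theorem refl {Γ : List R.Ty} {a : R.Ty} (s : Tm R Γ a) : s.Sim s :=
  Relation.EqvGen.refl s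

theorem symm {Γ : List R.Ty} {a : R.Ty} {s t : Tm R Γ a} (h : s.Sim t) : t.Sim s :=
  Relation.EqvGen.symm _ _ h

theorem trans {Γ : List R.Ty} {a : R.Ty} {s t r : Tm R Γ a} (h : s.Sim t) (h' : t.Sim r) :
    s.Sim r :=
  Relation.EqvGen.trans _ _ _ h h'

instance {Γ : List R.Ty} {a : R.Ty} : Trans (Tm.Sim (R := R) (Γ := Γ) (a := a)) Tm.Sim Tm.Sim :=
  ⟨trans⟩

theorem of_equiv {Γ : List R.Ty} {a : R.Ty} {s t : Tm R Γ a} (h : s.Equiv t) : s.Sim t :=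
  .rel _ _ (.inl h)

theorem of_beta {Γ : List R.Ty} {a : R.Ty} {s t : Tm R Γ a} (h : s.Beta t) : s.Sim t :=
  .rel _ _ (.inr (.inl h))

theorem of_etaAt {Γ : List R.Ty} {a : R.Ty} {r : Bool} {s t : Tm R Γ a} (h : s.EtaAt r t) :
    s.Sim t :=
  .rel _ _ (.inr (.inr ⟨r, h⟩))

theorem toSimSetoid {Γ : List R.Ty} {a : R.Ty} {s t : Tm R Γ a} (h : s.Sim t) :
    (Tm.simSetoid R Γ a).r s t :=
  eqvGen_lift id (fun _ _ hr => .rel _ _ (hr.imp id (.rel _ _))) h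

theorem cons_head {γ γ' as Γ : List R.Ty} {a : R.Ty} (h : Γ = γ ++ γ') {s t : Tm R γ a}
    (hs : s.Sim t) (ss : Tms R γ' as) : (Tms.cons γ γ' h s ss).Sim (Tms.cons γ γ' h t ss) := by
  refine eqvGen_lift (fun s => Tms.cons γ γ' h s ss) (fun x y hr => .rel _ _ ?_) hs
  rcases hr with hr | hr | ⟨r, hr⟩
  · exact .inl (.cons _ _ _ hr .rfl)
  · exact .inr (.inl (.head _ _ _ _ hr))
  · exact .inr (.inr (.head _ _ _ _ _ hr))

theorem cons_tail {γ γ' as Γ : List R.Ty} {a : R.Ty} (h : Γ = γ ++ γ') (s : Tm R γ a)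
    {ss ts : Tms R γ' as} (hs : ss.Sim ts) :
    (Tms.cons γ γ' h s ss).Sim (Tms.cons γ γ' h s ts) := by
  refine eqvGen_lift (fun ss => Tms.cons γ γ' h s ss) (fun x y hr => .rel _ _ ?_) hs
  rcases hr with hr | hr | hr
  · exact .inl (.cons _ _ _ (.refl _) hr)
  · exact .inr (.inl (.tail _ _ _ _ hr))
  · exact .inr (.inr (.tail _ _ _ _ hr))

theorem tuple {Γ as : List R.Ty} {ss ts : Tms R Γ as} (h : ss.Sim ts) :
    (Tm.tuple ss).Sim (Tm.tuple ts) := by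
  refine eqvGen_lift Tm.tuple (fun x y hr => .rel _ _ ?_) h
  rcases hr with hr | hr | hr
  · exact .inl (.tuple hr)
  · exact .inr (.inl (.tuple hr))
  · exact .inr (.inr ⟨_, .tuple hr⟩)

theorem body {Γ Δ δ as δ' γ : List R.Ty} {b : R.Ty} (hΔ : Δ = δ ++ as ++ δ')
    (hΓ : Γ = δ ++ γ ++ δ') {s s' : Tm R Δ b} (h : s.Sim s') (t : Tm R γ (RType.tensor as)) :
    (Tm.sub δ as δ' γ hΔ hΓ s t).Sim (Tm.sub δ as δ' γ hΔ hΓ s' t) := by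
  refine eqvGen_lift (fun s => Tm.sub δ as δ' γ hΔ hΓ s t) (fun x y hr => .rel _ _ ?_) h
  rcases hr with hr | hr | ⟨r, hr⟩
  · exact .inl (.sub _ _ _ _ _ _ hr (.refl _))
  · exact .inr (.inl (.body _ _ _ _ _ _ _ hr))
  · exact .inr (.inr ⟨_, .body _ _ _ _ _ _ _ _ hr⟩)

theorem sub_tuple {δ as δ' γ : List R.Ty} {b : R.Ty} (s : Tm R (δ ++ as ++ δ') b)
    (ts : Tms R γ as) : (Tm.sub δ as δ' γ rfl rfl s (Tm.tuple ts)).Sim (s.inst ts) :=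
  of_beta (Tm.Beta.root δ as δ' γ rfl rfl s LCtx.hole ts)

/-- `s[x⃗ := ⟨x⃗⟩] ∼ s`. -/
theorem sub_tuple_vars {Γ δ as δ' : List R.Ty} {b : R.Ty} (hΓ : Γ = δ ++ as ++ δ')
    (s : Tm R Γ b) : (Tm.sub δ as δ' as hΓ hΓ s (Tm.tuple (Tms.vars as))).Sim s := by
  subst hΓ
  refine (sub_tuple s _).trans ?_
  rw [Tm.inst, ← Tms.vars_append, ← Tms.vars_append, Tm.subst_vars]
  exact refl s

/-- `∼` is compatible with the right-hand side of an explicit substitution. Root `η`-steps are not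
allowed there, but they are derivable:
`s[x⃗ := ⟨y⃗⟩[y⃗ := t]] ≡ s[x⃗ := ⟨y⃗⟩][y⃗ := t] →_β s{x⃗ := y⃗}[y⃗ := t]`. -/
theorem arg {Γ Δ δ as δ' γ : List R.Ty} {b : R.Ty} (hΔ : Δ = δ ++ as ++ δ')
    (hΓ : Γ = δ ++ γ ++ δ') (s : Tm R Δ b) {t t' : Tm R γ (RType.tensor as)} (h : t.Sim t') :
    (Tm.sub δ as δ' γ hΔ hΓ s t).Sim (Tm.sub δ as δ' γ hΔ hΓ s t') := by
  refine eqvGen_lift (fun t => Tm.sub δ as δ' γ hΔ hΓ s t) (fun x y hr => ?_) h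
  rcases hr with hr | hr | ⟨r, hr⟩
  · exact of_equiv (.sub _ _ _ _ _ _ (.refl _) hr)
  · exact of_beta (.arg _ _ _ _ _ _ _ hr)
  · cases r with
    | false => exact of_etaAt (.arg _ _ _ _ _ _ _ hr)
    | true =>
      cases hr with
      | root _ _ =>
        refine symm ((of_equiv (Tm.Equiv.argComm' hΔ hΓ (by simp) (by simp) hΔ hΓ hΔ (by simp)
          (by simp) s (Tm.tuple (Tms.vars as)) x)).trans ?_)
        exact body hΔ hΓ (sub_tuple_vars hΔ s) x

/-- A `β`-redex that binds the whole context contracts to a simultaneous substitution. -/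
theorem sub_nil_nil {Γ Θ : List R.Ty} {b : R.Ty} (hΓ : Γ = [] ++ Γ ++ []) (hΘ : Θ = [] ++ Θ ++ [])
    (s : Tm R Γ b) (σ : Tms R Θ Γ) :
    (Tm.sub [] Γ [] Θ hΓ hΘ s (Tm.tuple σ)).Sim (s.subst σ) := by
  have key : ∀ {Γ' Θ' : List R.Ty} (h : Γ = Γ') (h' : Θ = Θ') (σ' : Tms R Θ' Γ'), HEq σ' σ →
      h' ▸ (h ▸ s).subst σ' = s.subst σ := by
    intro Γ' Θ' h h' σ' hσ
    subst h h'
    cases hσ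
    rfl
  rw [← key hΓ hΘ ((Tms.vars []).append σ |>.append (Tms.vars [])) (Tms.append_nil σ)]
  exact of_beta (Tm.Beta.root [] Γ [] Θ hΓ hΘ s LCtx.hole σ)

theorem subst {Γ Θ : List R.Ty} {b : R.Ty} {s t : Tm R Γ b} (h : s.Sim t) (σ : Tms R Θ Γ) :
    (s.subst σ).Sim (t.subst σ) :=
  ((sub_nil_nil (by simp) (by simp) s σ).symm.trans (body _ _ h _)).trans
    (sub_nil_nil (by simp) (by simp) t σ)

/-- Substitutions compose up to `∼`, since explicit substitutions compose up to `≡`. -/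
theorem subst_subst {Γ Δ Θ : List R.Ty} {b : R.Ty} (s : Tm R Γ b) (σ : Tms R Δ Γ) (τ : Tms R Θ Δ) :
    ((s.subst σ).subst τ).Sim (s.subst (σ.subst τ)) := by
  have h : ∀ Ξ : List R.Ty, Ξ = [] ++ Ξ ++ [] := by simp
  calc
    (s.subst σ).subst τ
    _ |>.Sim (Tm.sub [] Δ [] Θ (h _) (h _) (s.subst σ) (Tm.tuple τ)) :=
      (sub_nil_nil _ _ _ τ).symm
    _ |>.Sim (Tm.sub [] Δ [] Θ (h _) (h _) (Tm.sub [] Γ [] Δ (h _) (h _) s (Tm.tuple σ))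
        (Tm.tuple τ)) := body _ _ (sub_nil_nil _ _ s σ).symm _
    _ |>.Sim (Tm.sub [] Γ [] Θ (h _) (h _) s
        (Tm.sub [] Δ [] Θ (h _) (h _) (Tm.tuple σ) (Tm.tuple τ))) :=
      (of_equiv (Tm.Equiv.argComm' (δ := []) (δ' := []) (ε := []) (ε' := []) _ _ _ _ _ _ _
        rfl rfl s (Tm.tuple σ) (Tm.tuple τ))).symm
    _ |>.Sim (Tm.sub [] Γ [] Θ (h _) (h _) s (Tm.tuple (σ.subst τ))) := by
      refine arg _ _ s ((sub_nil_nil _ _ (Tm.tuple σ) τ).trans ?_)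
      rw [Tm.subst]
      exact refl _
    _ |>.Sim (s.subst (σ.subst τ)) := sub_nil_nil _ _ s _

end Tm.Sim

theorem Tm.not_isLT_var (as : List R.Ty) : ¬ (Tm.var (R := R) (RType.tensor as)).IsLT := by
  rintro ⟨ζ, L, ss, h⟩
  cases L with
  | hole => cases h
  | sub _ _ _ _ _ _ _ _ => cases h

/-! ### Coherence up to reduction -/

/-- `s ∼ s{x := ⟨y⃗⟩}[y⃗ := x]` for a variable `x` of tensor type: the `η`-expansion of `x` in
`s[x := ⟨x⟩]`, where the inner tuple is unary, is moved outwards. -/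
theorem Tm.Sim.sub_inst {δ bs δ' : List R.Ty} {b : R.Ty}
    (s : Tm R (δ ++ [RType.tensor bs] ++ δ') b) :
    s.Sim (Tm.sub δ bs δ' [RType.tensor bs] rfl rfl
      (s.inst (Tms.cons bs [] (List.append_nil bs).symm (Tm.tuple (Tms.vars bs)) Tms.nil))
      (Tm.var (RType.tensor bs))) := by
  refine (Tm.Sim.sub_tuple_vars rfl s).symm.trans ?_
  have hη : (Tm.var (R := R) (RType.tensor bs)).Sim (Tm.var (RType.tensor bs)).etaExpand :=
    Tm.Sim.of_etaAt (.root _ (Tm.not_isLT_var bs))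
  refine (Tm.Sim.arg rfl rfl s (Tm.Sim.tuple (Tm.Sim.cons_head _ hη Tms.nil))).trans ?_
  have e : bs = bs ++ [] := (List.append_nil bs).symm
  have hc : Tm.Equiv (Tm.tuple (Tms.cons [RType.tensor bs] [] rfl
        (Tm.var (RType.tensor bs)).etaExpand Tms.nil))
      (Tm.sub [] bs [] [RType.tensor bs] (by simp) rfl
        (Tm.tuple (Tms.cons bs [] e (Tm.tuple (Tms.vars bs)) Tms.nil))
        (Tm.var (RType.tensor bs))) := by
    have h := Tm.Equiv.tupleComm' (δ := []) (δ' := []) (Γ := [RType.tensor bs]) (by simp) rfl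
      Tms.nil (Tm.tuple (Tms.vars bs)) (Tm.var (RType.tensor bs)) Tms.nil
    -- `h` is about a tuple in context `bs ++ []`, which is equal to `bs` only propositionally.
    have key : ∀ {Δ : List R.Ty} (hΔ : Δ = bs) (h₁ : Δ = [] ++ bs ++ []) (h₂ : Δ = bs ++ []),
        Tm.sub (Γ := [RType.tensor bs]) [] bs [] [RType.tensor bs] h₁ rfl
          (Tm.tuple (Tms.cons bs [] h₂ (Tm.tuple (Tms.vars bs)) Tms.nil))
          (Tm.var (RType.tensor bs)) =
        Tm.sub [] bs [] [RType.tensor bs] (by simp) rfl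
          (Tm.tuple (Tms.cons bs [] e (Tm.tuple (Tms.vars bs)) Tms.nil))
          (Tm.var (RType.tensor bs)) := by
      intro Δ hΔ _ _
      subst hΔ
      rfl
    rw [← key (List.append_nil bs) (by simp) rfl]
    exact h
  refine (Tm.Sim.arg rfl rfl s (Tm.Sim.of_equiv hc)).trans ?_
  refine (Tm.Sim.of_equiv
    (Tm.Equiv.argComm' _ _ _ _ rfl rfl rfl (by simp) (by simp) s _ _)).trans ?_
  exact Tm.Sim.body _ _ (Tm.Sim.sub_tuple s _) _

theorem sizeOf_append {α : Type*} [SizeOf α] (l l' : List α) :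
    sizeOf (l ++ l') + 1 = sizeOf l + sizeOf l' := by
  induction l with
  | nil => simp; omega
  | cons a l ih => simp only [List.cons_append, List.cons.sizeOf_spec]; omega

theorem RType.atoms_or_exists_tensor {A : Type*} (Γ : List (RType A)) :
    (∀ x ∈ Γ, ∃ o, x = RType.atom o) ∨
      ∃ δ bs δ', Γ = δ ++ [RType.tensor bs] ++ δ' := by
  by_cases h : ∃ bs, RType.tensor bs ∈ Γ
  · obtain ⟨bs, hbs⟩ := h
    obtain ⟨δ, δ', rfl⟩ := List.append_of_mem hbs
    exact .inr ⟨δ, bs, δ', by simp⟩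
  · refine .inl fun x hx => ?_
    cases x with
    | atom o => exact ⟨o, rfl⟩
    | tensor bs => exact (h ⟨bs, hx⟩).elim

/-- Substituting tuple trees for all the variables reflects `∼`: by `Tm.Sim.sub_inst` one variable of
tensor type can be opened, and the context shrinks when a tensor is replaced by its factors. -/
theorem Tm.Sim.of_forall_subst_isTree {Γ : List R.Ty} {b : R.Ty} {s t : Tm R Γ b}
    (h : ∀ (Θ : List R.Ty) (σ : Tms R Θ Γ), σ.IsTree → (s.subst σ).Sim (t.subst σ)) : s.Sim t := by
  induction hn : sizeOf Γ using Nat.strong_induction_on generalizing Γ with | _ n ih => ?_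
  subst hn
  rcases RType.atoms_or_exists_tensor Γ with hΓ | ⟨δ, bs, δ', rfl⟩
  · simpa only [Tm.subst_vars] using h Γ (Tms.vars Γ) (Tms.isTree_vars hΓ)
  · refine (Tm.Sim.sub_inst s).trans ((Tm.Sim.body _ _ ?_ _).trans (Tm.Sim.sub_inst t).symm)
    have hlt : sizeOf (δ ++ bs ++ δ') < sizeOf (δ ++ [RType.tensor bs] ++ δ') := by
      have h₁ := sizeOf_append (δ ++ bs) δ'
      have h₂ := sizeOf_append δ bs
      have h₃ := sizeOf_append (δ ++ [RType.tensor bs]) δ'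
      have h₄ := sizeOf_append δ [RType.tensor bs]
      simp only [List.cons.sizeOf_spec, List.nil.sizeOf_spec, RType.tensor.sizeOf_spec] at h₄
      omega
    refine ih _ hlt (fun Θ σ hσ => ?_) rfl
    obtain ⟨_, Θ₃, rfl, σ, σ₃, rfl⟩ := Tms.exists_eq_append δ' (δ ++ bs) σ
    obtain ⟨Θ₁, Θ₂, rfl, σ₁, σ₂, rfl⟩ := Tms.exists_eq_append bs δ σ
    refine (Tm.Sim.subst_subst _ _ _).trans (Tm.Sim.trans ?_ (Tm.Sim.subst_subst _ _ _).symm)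
    apply h
    have hσ' := hσ
    simp only [Tms.isTree_append] at hσ'
    have hcons : ((Tms.cons bs [] (List.append_nil bs).symm (Tm.tuple (Tms.vars bs))
        Tms.nil).subst σ₂).IsTree := by
      have key : ∀ {Ξ : List R.Ty} (e : Ξ = bs ++ []) (ρ : Tms R Θ₂ Ξ), ρ.IsTree →
          ((Tms.cons bs [] e (Tm.tuple (Tms.vars bs)) Tms.nil).subst ρ).IsTree := by
        intro Ξ e ρ hρ
        subst e
        obtain ⟨_, _, rfl, ρ₁, ρ₂, rfl⟩ := Tms.exists_eq_append [] bs ρ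
        dsimp only at hρ ⊢
        rw [Tms.subst_cons, Tm.subst, Tms.vars_subst]
        exact (Tms.isTree_append ρ₁ ρ₂).1 hρ
      exact key _ _ hσ'.1.2
    rw [Tms.subst_append, Tms.subst_append, Tms.vars_subst, Tms.vars_subst]
    simp only [Tms.isTree_append]
    exact ⟨⟨hσ'.1.1, hcons⟩, hσ'.2⟩

mutual
/-- Over a discrete signature, a term becomes a tuple tree when its variables are replaced by tuple
trees: the right-hand side of an explicit substitution becomes a tuple of trees, and the resulting
`β`-redex substitutes trees into the body. -/
theorem Tm.subst_sim_isTree (hR : R.IsDiscrete) : ∀ {Γ : List R.Ty} {a : R.Ty} (s : Tm R Γ a)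
    {Θ : List R.Ty} (σ : Tms R Θ Γ), σ.IsTree → ∃ p : Tm R Θ a, p.IsTree ∧ (s.subst σ).Sim p
  | _, _, Tm.var a, Θ, Tms.cons γ _ h s Tms.nil, hσ => by
      obtain rfl : Θ = γ := by simpa using h
      exact ⟨s, hσ.1, Tm.Sim.refl _⟩
  | _, _, Tm.op f _, _, _, _ => ((hR _ _).false f).elim
  | _, _, Tm.tuple ss, _, σ, hσ => by
      obtain ⟨ps, hps, h⟩ := Tms.subst_sim_isTree hR ss σ hσ
      refine ⟨Tm.tuple ps, hps, ?_⟩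
      rw [Tm.subst]
      exact Tm.Sim.tuple h
  | _, _, Tm.sub δ as δ' γ hΔ hΓ s t, _, σ, hσ => by
      have ihs := fun Θ => Tm.subst_sim_isTree hR s (Θ := Θ)
      have iht := fun Θ => Tm.subst_sim_isTree hR t (Θ := Θ)
      subst hΔ hΓ
      obtain ⟨_, Θ₃, rfl, σ, σ₃, rfl⟩ := Tms.exists_eq_append δ' (δ ++ γ) σ
      obtain ⟨Θ₁, Θ₂, rfl, σ₁, σ₂, rfl⟩ := Tms.exists_eq_append γ δ σ
      have hσ' := hσ
      simp only [Tms.isTree_append] at hσ'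
      obtain ⟨q, hq, htq⟩ := iht _ σ₂ hσ'.1.2
      obtain ⟨qs, hqs, rfl⟩ := hq.exists_eq_tuple
      have hτ : ((σ₁.append qs).append σ₃).IsTree := by
        simp only [Tms.isTree_append]
        exact ⟨⟨hσ'.1.1, hqs⟩, hσ'.2⟩
      obtain ⟨p, hp, hsp⟩ := ihs _ _ hτ
      refine ⟨p, hp, ?_⟩
      rw [Tm.subst_sub]
      refine (Tm.Sim.arg _ _ _ htq).trans ((Tm.Sim.sub_tuple _ qs).trans ?_)
      refine (Tm.Sim.subst_subst _ _ _).trans ?_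
      rw [Tms.subst_append, Tms.subst_append, Tms.subst_vars, Tms.subst_vars, Tms.vars_subst]
      exact hsp
theorem Tms.subst_sim_isTree (hR : R.IsDiscrete) : ∀ {Γ as : List R.Ty} (ss : Tms R Γ as)
    {Θ : List R.Ty} (σ : Tms R Θ Γ), σ.IsTree → ∃ ps : Tms R Θ as, ps.IsTree ∧ (ss.subst σ).Sim ps
  | _, _, Tms.nil, _, σ, hσ => ⟨σ, hσ, .refl _⟩
  | _, _, Tms.cons γ γ' h s ss, _, σ, hσ => by
      have ihs := fun Θ => Tm.subst_sim_isTree hR s (Θ := Θ)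
      have ihss := fun Θ => Tms.subst_sim_isTree hR ss (Θ := Θ)
      subst h
      obtain ⟨Θ₁, Θ₂, rfl, σ, τ, rfl⟩ := Tms.exists_eq_append γ' γ σ
      have hσ' := hσ
      simp only [Tms.isTree_append] at hσ'
      obtain ⟨p, hp, h⟩ := ihs _ σ hσ'.1
      obtain ⟨ps, hps, h'⟩ := ihss _ τ hσ'.2
      refine ⟨Tms.cons _ _ rfl p ps, ⟨hp, hps⟩, ?_⟩
      rw [Tms.subst_cons]
      exact .trans _ _ _ (Tm.Sim.cons_head _ h _) (Tm.Sim.cons_tail _ _ h')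
end

theorem Tm.sim_of_isDiscrete (hR : R.IsDiscrete) {Γ : List R.Ty} {a : R.Ty} (s t : Tm R Γ a) :
    s.Sim t := by
  refine Tm.Sim.of_forall_subst_isTree fun Θ σ hσ => ?_
  obtain ⟨p, hp, h⟩ := Tm.subst_sim_isTree hR s σ hσ
  obtain ⟨q, hq, h'⟩ := Tm.subst_sim_isTree hR t σ hσ
  exact (hp.eq hq ▸ h).trans h'.symm

/-! ### Opened terms -/

/-- `bodyComm` with all contexts given up to equations. -/
theorem Tm.Equiv.bodyComm' {Γ Δ₀ Δ₁ Δ₂ δ₁ ys δ₂ xs δ₃ γ γ' ε₁ ε₂ ε₃ ε₄ : List R.Ty} {b : R.Ty}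
    (e₁ : ε₁ = δ₁ ++ ys ++ δ₂) (e₂ : ε₂ = δ₂ ++ γ ++ δ₃) (e₃ : ε₃ = δ₁ ++ γ' ++ δ₂)
    (e₄ : ε₄ = δ₂ ++ xs ++ δ₃)
    (h₁ : Δ₁ = δ₁ ++ ys ++ ε₂) (h₂ : Γ = δ₁ ++ γ' ++ ε₂) (h₃ : Δ₀ = ε₁ ++ xs ++ δ₃)
    (h₄ : Δ₁ = ε₁ ++ γ ++ δ₃) (h₅ : Δ₂ = ε₃ ++ xs ++ δ₃) (h₆ : Γ = ε₃ ++ γ ++ δ₃)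
    (h₇ : Δ₀ = δ₁ ++ ys ++ ε₄) (h₈ : Δ₂ = δ₁ ++ γ' ++ ε₄)
    (s : Tm R Δ₀ b) (t : Tm R γ (RType.tensor xs)) (u : Tm R γ' (RType.tensor ys)) :
    Tm.Equiv (Tm.sub δ₁ ys ε₂ γ' h₁ h₂ (Tm.sub ε₁ xs δ₃ γ h₃ h₄ s t) u)
      (Tm.sub ε₃ xs δ₃ γ h₅ h₆ (Tm.sub δ₁ ys ε₄ γ' h₇ h₈ s u) t) := by
  subst e₁ e₂ e₃ e₄ h₃ h₄ h₅ h₆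
  exact Tm.Equiv.bodyComm s t u

/-- The terms `p[x⃗₁ := y₁]⋯[x⃗ₙ := yₙ]` with `p` a tuple tree and the `yᵢ` variables: all variables of
tensor type, bound ones included, are opened by an explicit substitution. -/
inductive Tm.IsOpened : {Γ : List R.Ty} → {a : R.Ty} → Tm R Γ a → Prop
  | tree {Γ : List R.Ty} {a : R.Ty} {p : Tm R Γ a} (hp : p.IsTree) : Tm.IsOpened p
  | sub {Γ Δ : List R.Ty} {b : R.Ty} (δ as δ' : List R.Ty) (hΔ : Δ = δ ++ as ++ δ')
      (hΓ : Γ = δ ++ [RType.tensor as] ++ δ') {s : Tm R Δ b} (hs : s.IsOpened) :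
      Tm.IsOpened (Tm.sub δ as δ' [RType.tensor as] hΔ hΓ s (Tm.var (RType.tensor as)))

/-- Two ways to single out an entry of a list: the entries are the same, or one is left of the
other. -/
theorem append_singleton_append_eq {α : Type*} {l₁ l₂ r₁ r₂ : List α} {a b : α}
    (h : l₁ ++ [a] ++ r₁ = l₂ ++ [b] ++ r₂) :
    (l₁ = l₂ ∧ a = b ∧ r₁ = r₂) ∨ (∃ m, l₁ = l₂ ++ [b] ++ m ∧ r₂ = m ++ [a] ++ r₁) ∨
      ∃ m, l₂ = l₁ ++ [a] ++ m ∧ r₁ = m ++ [b] ++ r₂ := by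
  simp only [List.append_assoc, List.singleton_append] at h ⊢
  induction l₁ generalizing l₂ with
  | nil =>
    cases l₂ with
    | nil => simpa using h
    | cons c l₂ =>
      simp only [List.nil_append, List.cons_append, List.cons.injEq] at h
      exact .inr (.inr ⟨l₂, by simp [h.1], h.2⟩)
  | cons d l₁ ih =>
    cases l₂ with
    | nil =>
      simp only [List.nil_append, List.cons_append, List.cons.injEq] at h
      exact .inr (.inl ⟨l₁, by simp [h.1], h.2.symm⟩)
    | cons c l₂ =>
      simp only [List.cons_append, List.cons.injEq] at h
      obtain ⟨rfl, h⟩ := h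
      simpa using ih h

/-- Up to structural equivalence, any given variable of tensor type is the one that an opened term
opens outermost. -/
theorem Tm.IsOpened.exists_equiv_sub {Γ : List R.Ty} {b : R.Ty} {s : Tm R Γ b} (hs : s.IsOpened)
    {δ as δ' Δ : List R.Ty} (hΔ : Δ = δ ++ as ++ δ') (hΓ : Γ = δ ++ [RType.tensor as] ++ δ') :
    ∃ s' : Tm R Δ b, s'.IsOpened ∧
      s.Equiv (Tm.sub δ as δ' [RType.tensor as] hΔ hΓ s' (Tm.var _)) := by
  induction hs generalizing δ δ' Δ with
  | tree hp =>
    obtain ⟨o, ho⟩ := hp.eq_atom_of_mem (RType.tensor as) (by simp [hΓ])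
    cases ho
  | @sub Γ Δ₁ b ε bs ε' hΔ₁ hΓ₁ s hs ih =>
    rcases append_singleton_append_eq (hΓ₁.symm.trans hΓ) with
      ⟨rfl, h, rfl⟩ | ⟨m, rfl, rfl⟩ | ⟨m, rfl, rfl⟩
    · cases h
      subst hΔ hΔ₁
      exact ⟨s, hs, .refl _⟩
    · subst hΔ
      obtain ⟨s', hs', h⟩ := ih (δ := δ) (δ' := m ++ bs ++ ε') rfl (by simp [hΔ₁])
      refine ⟨_, .sub (δ ++ as ++ m) bs ε' (by simp) (by simp) hs', ?_⟩
      refine (Tm.Equiv.sub _ _ _ _ _ _ h (.refl _)).trans ?_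
      exact (Tm.Equiv.bodyComm' rfl rfl rfl rfl _ _ _ _ _ _ _ _ _ _ _).symm
    · subst hΔ
      obtain ⟨s', hs', h⟩ := ih (δ := ε ++ bs ++ m) (δ' := δ') rfl (by simp [hΔ₁])
      refine ⟨_, .sub ε bs (m ++ as ++ δ') (by simp) (by simp) hs', ?_⟩
      refine (Tm.Equiv.sub _ _ _ _ _ _ h (.refl _)).trans ?_
      exact Tm.Equiv.bodyComm' rfl rfl rfl rfl _ _ _ _ _ _ _ _ _ _ _

/-- Opened terms of the same context and type are structurally equivalent. -/
theorem Tm.IsOpened.equiv {Γ : List R.Ty} {b : R.Ty} {s t : Tm R Γ b} (hs : s.IsOpened)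
    (ht : t.IsOpened) : s.Equiv t := by
  induction hs with
  | tree hp =>
    cases ht with
    | tree hq => exact hp.eq hq ▸ .refl _
    | sub δ as δ' hΔ hΓ hs =>
      obtain ⟨o, ho⟩ := hp.eq_atom_of_mem (RType.tensor as) (by simp [hΓ])
      cases ho
  | sub δ as δ' hΔ hΓ hs ih =>
    obtain ⟨t', ht', h⟩ := ht.exists_equiv_sub hΔ hΓ
    exact (Tm.Equiv.sub _ _ _ _ _ _ (ih ht') (.refl _)).trans h.symm

/-- The terms that are structurally equivalent to opened ones. -/
def Tm.Opens {Γ : List R.Ty} {a : R.Ty} (s : Tm R Γ a) : Prop :=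
  ∃ t : Tm R Γ a, t.IsOpened ∧ s.Equiv t

/-- The sequences of terms that are structurally equivalent to opened ones. -/
def Tms.Opens : {Γ as : List R.Ty} → Tms R Γ as → Prop
  | _, _, Tms.nil => True
  | _, _, Tms.cons _ _ _ s ss => s.Opens ∧ ss.Opens

theorem Tms.Equiv.append_left : ∀ {Γ as : List R.Ty} (us : Tms R Γ as) {Γ' bs : List R.Ty}
    {ss ts : Tms R Γ' bs}, ss.Equiv ts → (us.append ss).Equiv (us.append ts)
  | _, _, Tms.nil, _, _, _, _, h => h
  | _, _, Tms.cons _ _ _ s us, _, _, _, _, h =>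
      .cons _ _ _ (.refl s) (Tms.Equiv.append_left us h)

theorem Tm.opens_tuple_of_heq {Γ Γ' as as' : List R.Ty} {ss : Tms R Γ as} {ss' : Tms R Γ' as'}
    (hΓ : Γ = Γ') (has : as = as') (h : HEq ss ss') (hs : (Tm.tuple ss).Opens) :
    (Tm.tuple ss').Opens := by
  subst hΓ has
  exact eq_of_heq h ▸ hs

/-- The explicit substitutions in the entries of a tuple can be moved out one after the other. The
prefix `us` holds the entries that are already trees. -/
theorem Tms.Opens.tuple_append : ∀ {Γ as : List R.Ty} {ss : Tms R Γ as}, ss.Opens →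
    ∀ {Γu bs : List R.Ty} {us : Tms R Γu bs}, us.IsTree → (Tm.tuple (us.append ss)).Opens
  | _, _, Tms.nil, _, _, _, us, hus =>
      ⟨_, .tree (p := Tm.tuple (us.append Tms.nil))
        ((Tms.isTree_append us Tms.nil).2 ⟨hus, trivial⟩), .refl _⟩
  | _, _, Tms.cons γ γ' h s ss, hopens, Γu, bs, us, hus => by
      obtain ⟨⟨t, ht, hst⟩, hss⟩ := hopens
      have ih := fun {Γu bs : List R.Ty} {us : Tms R Γu bs} =>
        Tms.Opens.tuple_append (ss := ss) hss (us := us)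
      subst h
      suffices hopen : (Tm.tuple (us.append (Tms.cons γ γ' rfl t ss))).Opens by
        obtain ⟨r, hr, htr⟩ := hopen
        exact ⟨r, hr, (Tm.Equiv.tuple (.append_left us (.cons _ _ _ hst .rfl))).trans htr⟩
      clear hst s
      induction ht with
      | @tree γ a p hp =>
        -- The first entry is a tree now and joins the prefix.
        have htree : (us.append (Tms.cons γ [] (List.append_nil γ).symm p Tms.nil)).IsTree :=
          (Tms.isTree_append _ _).2 ⟨hus, hp, trivial⟩
        exact Tm.opens_tuple_of_heq (List.append_assoc _ _ _) (List.append_assoc _ _ _)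
          (Tms.append_assoc _ _ _) (ih htree)
      | sub δ as δ' hΔ hΓ hs iht =>
        obtain ⟨r, hr, h⟩ := iht
        exact ⟨_, .sub _ _ _ _ _ hr, (Tm.Equiv.tupleComm' hΔ hΓ us _ _ ss).trans
          (.sub _ _ _ _ _ _ h (.refl _))⟩

/-! ### Normal terms -/

/-- The right-hand sides of explicit substitutions in normal terms are variables: if
`s[x⃗ := t]` is such a right-hand side, then `s` has tensor type and stands in a position where it
can be expanded unless it is of the shape `L[⟨s₁, …, sₖ⟩]`, which then `s[x⃗ := t]` is as well. -/
theorem Tm.exists_eq_var {Γ as : List R.Ty} (hR : R.IsDiscrete) (t : Tm R Γ (RType.tensor as))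
    (hη : ∀ t', ¬ Tm.EtaAt false t t') (ht : ¬ t.IsLT) :
    ∃ h : [RType.tensor as] = Γ, t = h ▸ Tm.var (RType.tensor as) := by
  cases t with
  | var a => exact ⟨rfl, rfl⟩
  | op f ss => exact ((hR _ _).false f).elim
  | tuple ss => exact (ht ⟨_, .hole, ss, rfl⟩).elim
  | sub δ xs δ' γ hΔ hΓ s t =>
    refine (hη _ (.body δ xs δ' γ hΔ hΓ true t (.root s ?_))).elim
    rintro ⟨ζ, L, ss, rfl⟩
    exact ht ⟨ζ, .sub δ xs δ' γ hΔ hΓ L t, ss, rfl⟩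

mutual
theorem Tm.opens_of_normal (hR : R.IsDiscrete) : ∀ {Γ : List R.Ty} {a : R.Ty} (s : Tm R Γ a),
    (∀ s', ¬ s.Beta s') → (∀ r s', ¬ Tm.EtaAt r s s') → s.Opens
  | _, _, Tm.var (RType.atom o), _, _ => ⟨_, .tree (p := Tm.var _) ⟨o, rfl⟩, .refl _⟩
  | _, _, Tm.var (RType.tensor as), _, hη => (hη _ _ (.root _ (Tm.not_isLT_var as))).elim
  | _, _, Tm.op f _, _, _ => ((hR _ _).false f).elim
  | _, _, Tm.tuple ss, hβ, hη =>
      (Tms.opens_of_normal hR ss (fun _ h => hβ _ (.tuple h))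
        (fun _ h => hη _ _ (.tuple h))).tuple_append (us := Tms.nil) trivial
  | _, _, Tm.sub δ as δ' γ hΔ hΓ s t, hβ, hη => by
      obtain ⟨r, hr, hsr⟩ := Tm.opens_of_normal hR s
        (fun _ h => hβ _ (.body δ as δ' γ hΔ hΓ t h))
        (fun _ _ h => hη _ _ (.body δ as δ' γ hΔ hΓ _ t h))
      obtain ⟨rfl, rfl⟩ := Tm.exists_eq_var hR t
        (fun _ h => hη _ _ (.arg δ as δ' γ hΔ hΓ s h)) (by
          rintro ⟨ζ, L, ss, rfl⟩
          exact hβ _ (.root δ as δ' γ hΔ hΓ s L ss))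
      exact ⟨_, .sub δ as δ' hΔ hΓ hr, .sub _ _ _ _ _ _ hsr (.refl _)⟩
theorem Tms.opens_of_normal (hR : R.IsDiscrete) : ∀ {Γ as : List R.Ty} (ss : Tms R Γ as),
    (∀ ss', ¬ ss.Beta ss') → (∀ ss', ¬ ss.Eta ss') → ss.Opens
  | _, _, Tms.nil, _, _ => trivial
  | _, _, Tms.cons γ γ' h s ss, hβ, hη =>
      ⟨Tm.opens_of_normal hR s (fun _ hs => hβ _ (.head γ γ' h ss hs))
        (fun _ _ hs => hη _ (.head γ γ' h _ ss hs)),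
      Tms.opens_of_normal hR ss (fun _ hs => hβ _ (.tail γ γ' h s hs))
        (fun _ hs => hη _ (.tail γ γ' h s hs))⟩
end

end RepCoh

theorem mainTheorem3 (R : RepCoh.RepSignature.{u, v}) (hR : R.IsDiscrete)
    (γ : List R.Ty) (a : R.Ty) :
    (∀ f g : RepCoh.FreeRM R γ a, f = g) ∧
      (∀ s t : RepCoh.Tm R γ a, s.IsNormal → t.IsNormal → RepCoh.Tm.Equiv s t) := by
  refine ⟨fun f g => ?_, fun s t hs ht => ?_⟩
  · induction f using Quotient.inductionOn with | _ s => ?_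
    induction g using Quotient.inductionOn with | _ t => ?_
    exact Quotient.sound (RepCoh.Tm.sim_of_isDiscrete hR s t).toSimSetoid
  · obtain ⟨s', hs', h⟩ := RepCoh.Tm.opens_of_normal hR s (fun s' h => hs s' (.inl h))
      (fun r s' h => hs s' (.inr ⟨r, h⟩))
    obtain ⟨t', ht', h'⟩ := RepCoh.Tm.opens_of_normal hR t (fun t' h => ht t' (.inl h))
      (fun r t' h => ht t' (.inr ⟨r, h⟩))
    exact (h.trans (hs'.equiv ht')).trans h'.symm
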